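/- Let $\Gamma=2\pi\mathbb{Z}^2$, $\Omega=(-\pi,\pi]^2$, $\mathbb{T}^2=\mathbb{R}^2/\Gamma$, and let $H^1(\mathbb{T}^2)$ be the completion of the smooth complex-valued $\Gamma$-periodic functions in the norm of the scalar product $(u,v)_{H^1}=\int_{\Omega}\left(u\overline{v}+\nabla u\cdot\nabla\overline{v}\right)dx$. Let $\epsilon(x,\omega)$, $x\in\mathbb{R}^2$, $\omega\in[\omega_0,\omega_1]\subset\mathbb{R}$, be real-valued and, for each $\omega$, measurable and $\Gamma$-periodic in $x$, with $0<c_0\le\epsilon(x,\omega)\le c_1$ for almost all $x$, where $c_0,c_1$ do not depend on $\omega$. Fix $\omega\in[\omega_0,\omega_1]$ and a unit vector $\hat k\in\mathbb{R}^2$, and for $u,v\in H^1(\mathbb{T}^2)$ put $$a_0(u,v)=\int_{\Omega}\left(\nabla u\cdot\nabla\overline{v}-\omega^2\epsilon(x,\omega)\,u\overline{v}\right)dx,\qquad a_1(u,v)=2\mathrm{i}\int_{\Omega}u\,\hat k\cdot\nabla\overline{v}\,dx,\qquad a_2(u,v)=\int_{\Omega}u\overline{v}\,dx .$$ Let $A_0,A_1,A_2$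 be the bounded linear operators on $H^1(\mathbb{T}^2)$ given by $(A_ju,v)_{H^1}=a_j(u,v)$, and let $Q(\lambda)=A_0+\lambda A_1+\lambda^2A_2$ for $\lambda\in\mathbb{C}$. The spectrum $\sigma(Q)$ is the set of all $\lambda\in\mathbb{C}$ for which $Q(\lambda)$ has no bounded inverse, and $\lambda$ is an eigenvalue if $Q(\lambda)u=0$ for some $u\neq0$; its multiplicity is $\dim\ker Q(\lambda)$. Theorem. The spectrum $\sigma(Q)$ is exactly the set of eigenvalues of $Q$, and every eigenvalue has finite multiplicity. Moreover, if $\lambda\in\sigma(Q)$, then also $-\lambda,\ \overline{\lambda},\ -\overline{\lambda}\in\sigma(Q)$. -/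

import Mathlib

open Set MeasureTheory
open scoped ComplexConjugate

noncomputable section

namespace BlochPencil

/-- Points `x = (x₁, x₂)` of the plane, with Lebesgue measure. -/
abbrev Plane : Type := Fin 2 → ℝ

/-- The vector `2π n` of the lattice `Γ = 2π ℤ²`. -/
def latticeVec (n : Fin 2 → ℤ) : Plane := fun j => 2 * Real.pi * (n j : ℝ)

/-- The fundamental periodicity domain `Ω = (-π, π]²` of the lattice. -/
def cell : Set Plane := Set.pi Set.univ fun _ => Set.Ioc (-Real.pi) Real.pi

/-- `ε(x, ω)` is a real permittivity on the frequency interval `[ω₀, ω₁]`: for each frequency of the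
interval it is a measurable `Γ`-periodic function of `x`, with `0 < c₀ ≤ ε(x, ω) ≤ c₁` for almost
all `x`, the constants being independent of the frequency. -/
structure IsPermittivity (ε : Plane → ℝ → ℝ) (ω₀ ω₁ : ℝ) : Prop where
  measurable : ∀ ω ∈ Set.Icc ω₀ ω₁, AEMeasurable (fun x => ε x ω) volume
  periodic : ∀ ω ∈ Set.Icc ω₀ ω₁, ∀ n : Fin 2 → ℤ,
    ∀ᵐ x ∂(volume : Measure Plane), ε (x + latticeVec n) ω = ε x ω
  bounds : ∃ c₀ c₁ : ℝ, 0 < c₀ ∧ ∀ ω ∈ Set.Icc ω₀ ω₁,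
    ∀ᵐ x ∂(volume : Measure Plane), c₀ ≤ ε x ω ∧ ε x ω ≤ c₁

/-- `C^∞(𝕋²)`: smooth complex-valued `Γ`-periodic functions on the plane. -/
structure IsSmoothPeriodic (φ : Plane → ℂ) : Prop where
  smooth : ContDiff ℝ ((⊤ : ℕ∞) : WithTop ℕ∞) φ
  periodic : ∀ (n : Fin 2 → ℤ) (x : Plane), φ (x + latticeVec n) = φ x

/-- The classical partial derivative `∂φ/∂x_j`. -/
def partialDeriv (j : Fin 2) (φ : Plane → ℂ) (x : Plane) : ℂ :=
  fderiv ℝ φ x (Pi.single j 1)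

/-- `L²(𝕋²)`, realised on the fundamental domain. -/
abbrev L2 : Type := Lp ℂ 2 ((volume : Measure Plane).restrict cell)

/-- The Hilbert space `L²(𝕋²) × L²(𝕋²)²` of pairs (function, vector field); its squared norm is
`‖w‖² + ‖g₁‖² + ‖g₂‖²`. -/
abbrev Jet : Type := WithLp 2 (L2 × PiLp 2 fun _ : Fin 2 => L2)

/-- The copy `{(φ, ∇φ) : φ ∈ C^∞(𝕋²)}` of `C^∞(𝕋²)` inside `L²(𝕋²) × L²(𝕋²)²`. The norm that it
inherits is the `H¹`-norm of `φ`. -/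
def smoothJets : Submodule ℂ Jet where
  carrier := {w | ∃ φ : Plane → ℂ, IsSmoothPeriodic φ ∧
    (w.fst : Plane → ℂ) =ᵐ[(volume : Measure Plane).restrict cell] φ ∧
    ∀ j, (w.snd j : Plane → ℂ) =ᵐ[(volume : Measure Plane).restrict cell] partialDeriv j φ}
  zero_mem' := by
    refine ⟨fun _ => 0, ⟨contDiff_const, fun _ _ => rfl⟩, ?_, fun j => ?_⟩
    · exact Lp.coeFn_zero ℂ 2 _
    · filter_upwards [Lp.coeFn_zero ℂ 2 ((volume : Measure Plane).restrict cell)] with x hx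
      simpa [partialDeriv] using hx
  add_mem' := by
    rintro a b ⟨φ, hφ, ha, ha'⟩ ⟨ψ, hψ, hb, hb'⟩
    refine ⟨fun x => φ x + ψ x, ⟨hφ.smooth.add hψ.smooth, fun n x => ?_⟩, ?_, fun j => ?_⟩
    · rw [hφ.periodic, hψ.periodic]
    · filter_upwards [Lp.coeFn_add a.fst b.fst, ha, hb] with x h1 h2 h3
      exact h1.trans (congrArg₂ (· + ·) h2 h3)
    · filter_upwards [Lp.coeFn_add (a.snd j) (b.snd j), ha' j, hb' j] with x h1 h2 h3
      have hd : partialDeriv j (fun x => φ x + ψ x) x = partialDeriv j φ x + partialDeriv j ψ x := by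
        unfold partialDeriv
        rw [fderiv_fun_add (hφ.smooth.differentiable (by simp)).differentiableAt
          (hψ.smooth.differentiable (by simp)).differentiableAt]
        rfl
      rw [hd, ← h2, ← h3]
      exact h1
  smul_mem' := by
    rintro c a ⟨φ, hφ, ha, ha'⟩
    refine ⟨fun x => c • φ x, ⟨hφ.smooth.const_smul c, fun n x => ?_⟩, ?_, fun j => ?_⟩
    · rw [hφ.periodic]
    · filter_upwards [Lp.coeFn_smul c a.fst, ha] with x h1 h2
      simp [h1, h2]
    · filter_upwards [Lp.coeFn_smul c (a.snd j), ha' j] with x h1 h2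
      have hd : partialDeriv j (fun x => c • φ x) x = c • partialDeriv j φ x := by
        unfold partialDeriv
        rw [fderiv_fun_const_smul (hφ.smooth.differentiable (by simp)).differentiableAt]
        rfl
      rw [hd, ← h2]
      exact h1

/-- `H¹(𝕋²)`: the completion of `C^∞(𝕋²)` in the `H¹`-norm, realised as the closure of
`{(φ, ∇φ) : φ ∈ C^∞(𝕋²)}` in the Hilbert space `L²(𝕋²) × L²(𝕋²)²`. Its scalar product is
`(u, v) = ∫ u v̄ + ∇u · ∇v̄` (Mathlib's `inner ℂ v u`). -/
def H1 : Type := smoothJets.topologicalClosure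

instance : NormedAddCommGroup H1 :=
  inferInstanceAs (NormedAddCommGroup smoothJets.topologicalClosure)

instance : InnerProductSpace ℂ H1 :=
  inferInstanceAs (InnerProductSpace ℂ smoothJets.topologicalClosure)

instance : CompleteSpace H1 :=
  inferInstanceAs (CompleteSpace smoothJets.topologicalClosure)

/-- An element of `H¹(𝕋²)` as a pair (function, gradient). -/
def jet (u : H1) : Jet := Subtype.val (p := fun w => w ∈ smoothJets.topologicalClosure) u

/-- An element of `H¹(𝕋²)` as a function. -/
def val (u : H1) : L2 := (jet u).fst

/-- The `j`-th component of the gradient of an element of `H¹(𝕋²)`. -/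
def grad (u : H1) (j : Fin 2) : L2 := (jet u).snd j

/-- `a₀(u, v) = ∫ ∇u · ∇v̄ - ω² ε(x, ω) u v̄ dx`. -/
def form0 (ε : Plane → ℝ → ℝ) (ω : ℝ) (u v : H1) : ℂ :=
  ∫ x in cell, ((∑ j, grad u j x * conj (grad v j x))
    - (ω : ℂ) ^ 2 * (ε x ω : ℂ) * val u x * conj (val v x))

/-- `a₁(u, v) = 2i ∫ u k̂ · ∇v̄ dx`. -/
def form1 (k : EuclideanSpace ℝ (Fin 2)) (u v : H1) : ℂ :=
  2 * Complex.I * ∫ x in cell, val u x * ∑ j, (k j : ℂ) * conj (grad v j x)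

/-- `a₂(u, v) = ∫ u v̄ dx`. -/
def form2 (u v : H1) : ℂ := ∫ x in cell, val u x * conj (val v x)

/-- Bounded sesquilinear forms (linear in the first, antilinear in the second argument). -/
structure IsBoundedSesquilinear (a : H1 → H1 → ℂ) : Prop where
  add_left : ∀ u u' v, a (u + u') v = a u v + a u' v
  smul_left : ∀ (c : ℂ) u v, a (c • u) v = c * a u v
  add_right : ∀ u v v', a u (v + v') = a u v + a u v'
  smul_right : ∀ (c : ℂ) u v, a u (c • v) = conj c * a u v
  bound : ∃ C : ℝ, ∀ u v, ‖a u v‖ ≤ C * ‖u‖ * ‖v‖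

/-- For fixed `u`, the bounded linear functional `v ↦ conj (a(u, v))`. -/
def IsBoundedSesquilinear.functional {a : H1 → H1 → ℂ} (ha : IsBoundedSesquilinear a) (u : H1) :
    StrongDual ℂ H1 :=
  LinearMap.mkContinuousOfExistsBound
    { toFun := fun v => conj (a u v)
      map_add' := fun v v' => by rw [ha.add_right, map_add]
      map_smul' := fun c v => by simp [ha.smul_right] }
    (by
      obtain ⟨C, hC⟩ := ha.bound
      exact ⟨C * ‖u‖, fun v => by simpa using hC u v⟩)

/-- The operator `A` on `H¹(𝕋²)` that the Riesz theorem associates with the bounded sesquilinear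
form `a`, that is `(A u, v) = a(u, v)`; see `inner_riesz`. -/
def IsBoundedSesquilinear.riesz {a : H1 → H1 → ℂ} (ha : IsBoundedSesquilinear a) :
    H1 →L[ℂ] H1 :=
  LinearMap.mkContinuousOfExistsBound
    { toFun := fun u => (InnerProductSpace.toDual ℂ H1).symm (ha.functional u)
      map_add' := fun u u' => by
        rw [← map_add]
        congr 1
        ext v
        change conj (a (u + u') v) = conj (a u v) + conj (a u' v)
        rw [ha.add_left, map_add]
      map_smul' := fun c u => by
        have h : ha.functional (c • u) = conj c • ha.functional u := by
          ext v
          change conj (a (c • u) v) = conj c * conj (a u v)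
          rw [ha.smul_left, map_mul]
        rw [h, LinearIsometryEquiv.map_smulₛₗ]
        simp }
    (by
      obtain ⟨C, hC⟩ := ha.bound
      refine ⟨|C|, fun u => ?_⟩
      change ‖(InnerProductSpace.toDual ℂ H1).symm (ha.functional u)‖ ≤ _
      rw [LinearIsometryEquiv.norm_map]
      refine ContinuousLinearMap.opNorm_le_bound _ (by positivity) fun v => ?_
      change ‖conj (a u v)‖ ≤ _
      rw [RCLike.norm_conj]
      refine (hC u v).trans ?_
      gcongr
      exact le_abs_self C)

/-- The defining property `(A u, v) = a(u, v)` of the operator associated with a form. -/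
theorem inner_riesz {a : H1 → H1 → ℂ} (ha : IsBoundedSesquilinear a) (u v : H1) :
    inner ℂ v (ha.riesz u) = a u v := by
  refine (inner_conj_symm (𝕜 := ℂ) v (ha.riesz u)).symm.trans ?_
  change conj (inner ℂ ((InnerProductSpace.toDual ℂ H1).symm (ha.functional u)) v) = _
  rw [InnerProductSpace.toDual_symm_apply]
  exact Complex.conj_conj _

theorem val_add (u v : H1) : val (u + v) = val u + val v := rfl
theorem val_smul (c : ℂ) (u : H1) : val (c • u) = c • val u := rfl
theorem grad_add (u v : H1) (j : Fin 2) : grad (u + v) j = grad u j + grad v j := rfl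
theorem grad_smul (c : ℂ) (u : H1) (j : Fin 2) : grad (c • u) j = c • grad u j := rfl

theorem norm_val_le (u : H1) : ‖val u‖ ≤ ‖u‖ := by
  have h : ‖u‖ ^ 2 = ‖val u‖ ^ 2 + ‖(jet u).snd‖ ^ 2 := WithLp.prod_norm_sq_eq_of_L2 (jet u)
  nlinarith [norm_nonneg u, norm_nonneg (val u), sq_nonneg ‖(jet u).snd‖]

theorem norm_grad_le (u : H1) (j : Fin 2) : ‖grad u j‖ ≤ ‖u‖ := by
  have h : ‖u‖ ^ 2 = ‖val u‖ ^ 2 + ‖(jet u).snd‖ ^ 2 := WithLp.prod_norm_sq_eq_of_L2 (jet u)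
  have h' : ‖grad u j‖ ≤ ‖(jet u).snd‖ := PiLp.norm_apply_le (jet u).snd j
  refine h'.trans ?_
  nlinarith [norm_nonneg u, norm_nonneg (jet u).snd, sq_nonneg ‖val u‖]

/-- The weighted form `∫ m f ḡ dx` on `L²(𝕋²)`. -/
def weighted (m : Plane → ℂ) (f g : L2) : ℂ := ∫ x in cell, m x * (f x * conj (g x))

/-- A measurable weight that is bounded almost everywhere on the fundamental domain. -/
def IsWeight (m : Plane → ℂ) : Prop :=
  AEStronglyMeasurable m ((volume : Measure Plane).restrict cell) ∧
    ∃ C : ℝ, ∀ᵐ x ∂((volume : Measure Plane).restrict cell), ‖m x‖ ≤ C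

theorem integrable_weighted {m : Plane → ℂ} (hm : IsWeight m) (f g : L2) :
    Integrable (fun x => m x * (f x * conj (g x))) ((volume : Measure Plane).restrict cell) := by
  obtain ⟨hm, C, hC⟩ := hm
  have h : Integrable (fun x => f x * conj (g x)) ((volume : Measure Plane).restrict cell) := by
    simpa [RCLike.inner_apply] using L2.integrable_inner (𝕜 := ℂ) g f
  exact h.bdd_mul hm hC

theorem weighted_bound {m : Plane → ℂ} (hm : IsWeight m) :
    ∃ C : ℝ, 0 ≤ C ∧ ∀ f g : L2, ‖weighted m f g‖ ≤ C * ‖f‖ * ‖g‖ := by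
  obtain ⟨hm, C, hC⟩ := id hm
  refine ⟨|C|, abs_nonneg C, fun f g => ?_⟩
  have hC' : ∀ᵐ x ∂((volume : Measure Plane).restrict cell), ‖m x‖ ≤ |C| :=
    hC.mono fun x hx => hx.trans (le_abs_self C)
  have hnorm (h : L2) : MemLp (fun x => ‖h x‖) 2 ((volume : Measure Plane).restrict cell) :=
    (Lp.memLp h).norm
  have hint : Integrable (fun x => ‖f x‖ * ‖g x‖) ((volume : Measure Plane).restrict cell) :=
    (hnorm f).integrable_mul (hnorm g)
  have hinner : ∫ x in cell, ‖f x‖ * ‖g x‖ ≤ ‖f‖ * ‖g‖ := by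
    have h1 := integral_mul_le_Lp_mul_Lq_of_nonneg (μ := (volume : Measure Plane).restrict cell)
      (f := fun x => ‖f x‖) (g := fun x => ‖g x‖) Real.HolderConjugate.two_two
      (Filter.Eventually.of_forall fun x => norm_nonneg _)
      (Filter.Eventually.of_forall fun x => norm_nonneg _)
      (by simpa using hnorm f) (by simpa using hnorm g)
    have h2 (h : L2) : (∫ x in cell, ‖h x‖ ^ (2 : ℝ)) ^ (1 / (2 : ℝ)) = ‖h‖ := by
      have h3 : ((‖h‖ ^ 2 : ℝ) : ℂ) = ((∫ x in cell, ‖h x‖ ^ (2 : ℝ) : ℝ) : ℂ) := by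
        have h4 := inner_self_eq_norm_sq_to_K (𝕜 := ℂ) h
        rw [L2.inner_def] at h4
        refine Eq.trans ?_ (integral_ofReal (𝕜 := ℂ)
          (f := fun x => ‖h x‖ ^ (2 : ℝ)))
        push_cast
        refine h4.symm.trans (integral_congr_ae (Filter.Eventually.of_forall fun x => ?_))
        simp
      rw [← Complex.ofReal_inj.mp h3, ← Real.sqrt_eq_rpow, Real.sqrt_sq (norm_nonneg h)]
    rw [h2 f, h2 g] at h1
    exact h1
  calc ‖weighted m f g‖ ≤ ∫ x in cell, |C| * (‖f x‖ * ‖g x‖) := by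
        refine norm_integral_le_of_norm_le (hint.const_mul _) (hC'.mono fun x hx => ?_)
        rw [norm_mul, norm_mul, RCLike.norm_conj]
        gcongr
    _ = |C| * ∫ x in cell, ‖f x‖ * ‖g x‖ := integral_const_mul _ _
    _ ≤ |C| * (‖f‖ * ‖g‖) := by gcongr
    _ = |C| * ‖f‖ * ‖g‖ := by ring

theorem weighted_add_left {m : Plane → ℂ} (hm : IsWeight m) (f f' g : L2) :
    weighted m (f + f') g = weighted m f g + weighted m f' g := by
  unfold weighted
  rw [← integral_add (integrable_weighted hm f g) (integrable_weighted hm f' g)]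
  refine integral_congr_ae ?_
  filter_upwards [Lp.coeFn_add f f'] with x hx
  rw [hx, Pi.add_apply]
  ring

theorem weighted_add_right {m : Plane → ℂ} (hm : IsWeight m) (f g g' : L2) :
    weighted m f (g + g') = weighted m f g + weighted m f g' := by
  unfold weighted
  rw [← integral_add (integrable_weighted hm f g) (integrable_weighted hm f g')]
  refine integral_congr_ae ?_
  filter_upwards [Lp.coeFn_add g g'] with x hx
  rw [hx, Pi.add_apply, map_add]
  ring

theorem weighted_smul_left (m : Plane → ℂ) (c : ℂ) (f g : L2) :
    weighted m (c • f) g = c * weighted m f g := by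
  unfold weighted
  rw [← integral_const_mul]
  refine integral_congr_ae ?_
  filter_upwards [Lp.coeFn_smul c f] with x hx
  rw [hx, Pi.smul_apply, smul_eq_mul]
  ring

theorem weighted_smul_right (m : Plane → ℂ) (c : ℂ) (f g : L2) :
    weighted m f (c • g) = conj c * weighted m f g := by
  unfold weighted
  rw [← integral_const_mul]
  refine integral_congr_ae ?_
  filter_upwards [Lp.coeFn_smul c g] with x hx
  rw [hx, Pi.smul_apply, smul_eq_mul, map_mul]
  ring

theorem isBoundedSesquilinear_weighted {m : Plane → ℂ} (hm : IsWeight m) (S T : H1 → L2)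
    (hS : ∀ u v, S (u + v) = S u + S v) (hS' : ∀ (c : ℂ) u, S (c • u) = c • S u)
    (hSb : ∀ u, ‖S u‖ ≤ ‖u‖)
    (hT : ∀ u v, T (u + v) = T u + T v) (hT' : ∀ (c : ℂ) u, T (c • u) = c • T u)
    (hTb : ∀ u, ‖T u‖ ≤ ‖u‖) :
    IsBoundedSesquilinear fun u v => weighted m (S u) (T v) where
  add_left u u' v := by rw [hS, weighted_add_left hm]
  smul_left c u v := by rw [hS', weighted_smul_left]
  add_right u v v' := by rw [hT, weighted_add_right hm]
  smul_right c u v := by rw [hT', weighted_smul_right]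
  bound := by
    obtain ⟨C, hC0, hC⟩ := weighted_bound hm
    refine ⟨C, fun u v => (hC _ _).trans ?_⟩
    have := hSb u
    have := hTb v
    gcongr

theorem IsBoundedSesquilinear.add {a b : H1 → H1 → ℂ} (ha : IsBoundedSesquilinear a)
    (hb : IsBoundedSesquilinear b) : IsBoundedSesquilinear fun u v => a u v + b u v where
  add_left u u' v := by rw [ha.add_left, hb.add_left]; ring
  smul_left c u v := by rw [ha.smul_left, hb.smul_left]; ring
  add_right u v v' := by rw [ha.add_right, hb.add_right]; ring
  smul_right c u v := by rw [ha.smul_right, hb.smul_right]; ring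
  bound := by
    obtain ⟨C, hC⟩ := ha.bound
    obtain ⟨D, hD⟩ := hb.bound
    refine ⟨C + D, fun u v => (norm_add_le _ _).trans ?_⟩
    linarith [hC u v, hD u v]

theorem isWeight_const (c : ℂ) : IsWeight fun _ => c :=
  ⟨aestronglyMeasurable_const, ‖c‖, Filter.Eventually.of_forall fun _ => le_rfl⟩

theorem isWeight_permittivity {ε : Plane → ℝ → ℝ} {ω₀ ω₁ : ℝ} (hε : IsPermittivity ε ω₀ ω₁)
    {ω : ℝ} (hω : ω ∈ Set.Icc ω₀ ω₁) : IsWeight fun x => -((ω : ℂ) ^ 2 * (ε x ω : ℂ)) := by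
  constructor
  · exact (((Complex.measurable_ofReal.comp_aemeasurable
      (hε.measurable ω hω).restrict).const_mul _).neg).aestronglyMeasurable
  · obtain ⟨c₀, c₁, h0, h⟩ := hε.bounds
    refine ⟨|ω| ^ 2 * c₁, ?_⟩
    filter_upwards [ae_restrict_of_ae (h ω hω)] with x hx
    rw [norm_neg, norm_mul, norm_pow, Complex.norm_real, Complex.norm_real, Real.norm_eq_abs,
      Real.norm_eq_abs, abs_of_nonneg (h0.le.trans hx.1)]
    exact mul_le_mul_of_nonneg_left hx.2 (by positivity)

theorem isBoundedSesquilinear_form0 {ε : Plane → ℝ → ℝ} {ω₀ ω₁ : ℝ} (hε : IsPermittivity ε ω₀ ω₁)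
    {ω : ℝ} (hω : ω ∈ Set.Icc ω₀ ω₁) : IsBoundedSesquilinear (form0 ε ω) := by
  have hw := isWeight_permittivity hε hω
  have h1 := isWeight_const 1
  have key := ((isBoundedSesquilinear_weighted h1 (fun u => grad u 0) (fun u => grad u 0)
    (fun u v => grad_add u v 0) (fun c u => grad_smul c u 0) (fun u => norm_grad_le u 0)
    (fun u v => grad_add u v 0) (fun c u => grad_smul c u 0) (fun u => norm_grad_le u 0)).add
    (isBoundedSesquilinear_weighted h1 (fun u => grad u 1) (fun u => grad u 1)
    (fun u v => grad_add u v 1) (fun c u => grad_smul c u 1) (fun u => norm_grad_le u 1)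
    (fun u v => grad_add u v 1) (fun c u => grad_smul c u 1) (fun u => norm_grad_le u 1))).add
    (isBoundedSesquilinear_weighted hw val val val_add val_smul norm_val_le
      val_add val_smul norm_val_le)
  convert key using 3 with u v
  unfold weighted form0
  rw [← integral_add (integrable_weighted h1 _ _) (integrable_weighted h1 _ _)]
  refine Eq.trans ?_ (integral_add ((integrable_weighted h1 _ _).add (integrable_weighted h1 _ _))
    (integrable_weighted hw _ _))
  refine integral_congr_ae (Filter.Eventually.of_forall fun x => ?_)
  simp only [Fin.sum_univ_two]
  ring

theorem isBoundedSesquilinear_form1 (k : EuclideanSpace ℝ (Fin 2)) :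
    IsBoundedSesquilinear (form1 k) := by
  have hw (j : Fin 2) := isWeight_const (2 * Complex.I * (k j : ℂ))
  have key := (isBoundedSesquilinear_weighted (hw 0) val (fun u => grad u 0) val_add val_smul
    norm_val_le
    (fun u v => grad_add u v 0) (fun c u => grad_smul c u 0) (fun u => norm_grad_le u 0)).add
    (isBoundedSesquilinear_weighted (hw 1) val (fun u => grad u 1) val_add val_smul norm_val_le
    (fun u v => grad_add u v 1) (fun c u => grad_smul c u 1) (fun u => norm_grad_le u 1))
  convert key using 3 with u v
  unfold weighted form1
  rw [← integral_add (integrable_weighted (hw 0) _ _) (integrable_weighted (hw 1) _ _),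
    ← integral_const_mul]
  refine integral_congr_ae (Filter.Eventually.of_forall fun x => ?_)
  simp only [Fin.sum_univ_two]
  ring

theorem isBoundedSesquilinear_form2 : IsBoundedSesquilinear form2 := by
  convert isBoundedSesquilinear_weighted (isWeight_const 1) val val val_add val_smul norm_val_le
      val_add val_smul norm_val_le using 3 with u v
  simp [weighted, form2]

/-- The bounded operator `A₀` with `(A₀ u, v) = a₀(u, v)`. -/
def opA0 {ε : Plane → ℝ → ℝ} {ω₀ ω₁ : ℝ} (hε : IsPermittivity ε ω₀ ω₁)
    {ω : ℝ} (hω : ω ∈ Set.Icc ω₀ ω₁) : H1 →L[ℂ] H1 :=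
  (isBoundedSesquilinear_form0 hε hω).riesz

/-- The bounded operator `A₁` with `(A₁ u, v) = a₁(u, v)`. -/
def opA1 (k : EuclideanSpace ℝ (Fin 2)) : H1 →L[ℂ] H1 :=
  (isBoundedSesquilinear_form1 k).riesz

/-- The bounded operator `A₂` with `(A₂ u, v) = a₂(u, v)`. -/
def opA2 : H1 →L[ℂ] H1 := isBoundedSesquilinear_form2.riesz

/-- The quadratic operator pencil `Q(z) = A₀ + z A₁ + z² A₂`. -/
def pencil {ε : Plane → ℝ → ℝ} {ω₀ ω₁ : ℝ} (hε : IsPermittivity ε ω₀ ω₁)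
    {ω : ℝ} (hω : ω ∈ Set.Icc ω₀ ω₁) (k : EuclideanSpace ℝ (Fin 2)) (z : ℂ) : H1 →L[ℂ] H1 :=
  opA0 hε hω + z • opA1 k + z ^ 2 • opA2

/-- The spectrum of an operator function: the points at which its value is not continuously
invertible. -/
def pencilSpectrum (T : ℂ → H1 →L[ℂ] H1) : Set ℂ := {z | ¬ IsUnit (T z)}

/-- The eigenvalues of an operator function: `T(z) u = 0` for some `u ≠ 0`. -/
def pencilEigenvalues (T : ℂ → H1 →L[ℂ] H1) : Set ℂ := {z | ∃ u : H1, u ≠ 0 ∧ T z u = 0}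

end BlochPencil

end

/-! The principal part of `form0` is the `H¹` product up to the term `∫ u v̄`, so `Q(λ)` is the
identity plus terms of lower order. In `((1 - Q(λ))u, v)` the function `u` appears only
undifferentiated, since the gradient in `form1` falls on `v`. Testing with `v = (1 - Q(λ))u` gives
`‖(1 - Q(λ))u‖ ≤ C ‖u‖_{L²}` (`exists_norm_one_sub_pencil_le`). By Rellich's theorem
(`isCompactOperator_valL`) and `IsCompactOperator.of_norm_le`, `1 - Q(λ)` is compact, and the
Fredholm alternative yields both the equality of spectrum and eigenvalues and the finite
multiplicity.

Rellich's theorem comes from Fourier series: the `n`-th coefficient of `∂ⱼu` is `i nⱼ` times that of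
`u`, so truncation to `|nⱼ| ≤ N` approximates the embedding into `L²` in operator norm up to `1/(N +
1)`, by operators of finite rank.

The symmetries have two sources. The three forms are Hermitian, so `Q(λ)* = Q(λ̄)`, and an operator
is invertible together with its adjoint. Conjugating functions fixes `a₀` and `a₂` up to conjugation
but reverses the sign of `a₁`, so `Q(λ)u = 0` implies `Q(-λ̄)ū = 0`. Composing the two gives `-λ`.
-/

/-! ### Compact operators and the Fredholm alternative -/

/-- An operator dominated in norm by a compact operator is compact. -/
theorem IsCompactOperator.of_norm_le {E F G : Type*} [NormedAddCommGroup E] [NormedSpace ℂ E]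
    [NormedAddCommGroup F] [NormedSpace ℂ F] [NormedAddCommGroup G] [NormedSpace ℂ G]
    [CompleteSpace G] {T : E →L[ℂ] F} {K : E →L[ℂ] G} (hT : IsCompactOperator T) {C : ℝ}
    (hK : ∀ u, ‖K u‖ ≤ C * ‖T u‖) : IsCompactOperator K := by
  have hT1 := hT.isCompact_closure_image_closedBall (f := T.toLinearMap) 1
  refine (isCompactOperator_iff_isCompact_closure_image_closedBall K.toLinearMap one_pos).2 ?_
  have hTB : TotallyBounded (T '' Metric.closedBall 0 1) :=
    hT1.totallyBounded.subset subset_closure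
  suffices h : TotallyBounded (K '' Metric.closedBall 0 1) from
    h.closure.isCompact_of_isClosed isClosed_closure
  rw [Metric.totallyBounded_iff]
  intro δ hδ
  -- The net is chosen inside the image under `T`, so that its points have preimages in the ball,
  -- whose images under `K` form a `δ`-net. Dividing by `|C| + 1` avoids any assumption on the sign
  -- of `C`.
  obtain ⟨t, hts, htf, ht⟩ := Metric.finite_approx_of_totallyBounded hTB (δ / (|C| + 1))
    (by positivity)
  choose g hgB hg using hts
  let s : Set G := {y | ∃ p, ∃ hp : p ∈ t, K (g hp) = y}
  have hs : s.Finite := by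
    have := htf.to_subtype
    refine (Set.finite_range fun p : t => K (g p.2)).subset ?_
    rintro y ⟨p, hp, rfl⟩
    exact ⟨⟨p, hp⟩, rfl⟩
  refine ⟨s, hs, ?_⟩
  rintro _ ⟨u, hu, rfl⟩
  obtain ⟨p, hp, hup⟩ := Set.mem_iUnion₂.1 (ht ⟨u, hu, rfl⟩)
  refine Set.mem_iUnion₂.2 ⟨K (g hp), ⟨p, hp, rfl⟩, ?_⟩
  rw [Metric.mem_ball, dist_eq_norm, ← hg hp, ← map_sub, lt_div_iff₀ (by positivity)] at hup
  rw [Metric.mem_ball, dist_eq_norm, ← map_sub]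
  calc ‖K (u - g hp)‖ ≤ C * ‖T (u - g hp)‖ := hK _
    _ ≤ ‖T (u - g hp)‖ * (|C| + 1) := by
      rw [mul_comm]
      gcongr
      linarith [le_abs_self C]
    _ < δ := hup

/-- The Fredholm alternative for compact perturbations of the identity. -/
theorem ContinuousLinearMap.fredholm_alternative {E : Type*} [NormedAddCommGroup E]
    [InnerProductSpace ℂ E] [CompleteSpace E] {Q : E →L[ℂ] E}
    (hQ : IsCompactOperator (1 - Q : E →L[ℂ] E)) :
    (¬ IsUnit Q ↔ ∃ u, u ≠ 0 ∧ Q u = 0) ∧ FiniteDimensional ℂ (LinearMap.ker Q.toLinearMap) := by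
  -- Both claims about `Q` are Riesz theory for the compact operator `1 - Q` at the nonzero spectral
  -- value `1`.
  have hker : Module.End.eigenspace (1 - Q : E →L[ℂ] E).toLinearMap 1 =
      LinearMap.ker Q.toLinearMap := by
    ext u
    simp
  constructor
  · have h := hQ.hasEigenvalue_iff_mem_spectrum one_ne_zero
    rw [spectrum.mem_iff, map_one, sub_sub_cancel] at h
    rw [← h, Module.End.hasEigenvalue_iff, hker, Submodule.ne_bot_iff]
    simp [and_comm]
  · rw [← hker]
    exact ContinuousLinearMap.finite_dimensional_eigenspace hQ 1 one_ne_zero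

/-! ### Expansions in an orthonormal family -/

/-- The closed span is the isometric image of `ℓ²`, so `x = ∑ f i • e i` for some `f`, and pairing
with `e i` identifies `f i`. Completeness of the family is required only at the given `x`, so
density of its span in `E` is never needed. -/
theorem Orthonormal.hasSum_of_mem_closure_span {ι E : Type*} [NormedAddCommGroup E]
    [InnerProductSpace ℂ E] [CompleteSpace E] {e : ι → E} (he : Orthonormal ℂ e) {x : E}
    (hx : x ∈ (Submodule.span ℂ (Set.range e)).topologicalClosure) :
    HasSum (fun i => (inner ℂ (e i) x : ℂ) • e i) x := by
  classical
  have hr := he.orthogonalFamily.range_linearIsometry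
  have hspan : (⨆ i, LinearMap.range (LinearIsometry.toSpanSingleton ℂ E (he.1 i)).toLinearMap) =
      Submodule.span ℂ (Set.range e) := by
    simp [← LinearMap.span_singleton_eq_range, ← Submodule.span_iUnion]
  rw [hspan] at hr
  rw [← hr] at hx
  obtain ⟨f, rfl⟩ := hx
  have hs := he.orthogonalFamily.hasSum_linearIsometry f
  convert! hs using 2 with i
  have h2 := (innerSL ℂ (e i)).hasSum hs
  have h3 : HasSum (fun j => if j = i then f i else 0) (f i) := hasSum_ite_eq i (f i)
  have h4 : (inner ℂ (e i) (he.orthogonalFamily.linearIsometry f) : ℂ) = f i := by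
    refine h2.unique ?_
    convert! h3 using 2 with j
    have := orthonormal_iff_ite.1 he i j
    simp only [LinearIsometry.toSpanSingleton_apply, innerSL_apply_apply, inner_smul_right, this]
    by_cases hij : j = i
    · subst hij
      simp
    · simp [hij, Ne.symm hij]
  rw [LinearIsometry.toSpanSingleton_apply]
  exact congrArg (· • e i) h4

/-- The remainder is the limit of the sums over `t \ s` with `t ⊇ s`, each controlled by Pythagoras.
Bounding finite sums off `s` avoids infinite tail sums. -/
theorem Orthonormal.norm_sub_sum_le {ι E : Type*} [NormedAddCommGroup E]
    [InnerProductSpace ℂ E] [CompleteSpace E] {e : ι → E} (he : Orthonormal ℂ e) {x : E}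
    (hx : x ∈ (Submodule.span ℂ (Set.range e)).topologicalClosure) (s : Finset ι) {R : ℝ}
    (hR : 0 ≤ R)
    (h : ∀ t : Finset ι, Disjoint s t → ∑ i ∈ t, ‖(inner ℂ (e i) x : ℂ)‖ ^ 2 ≤ R ^ 2) :
    ‖x - ∑ i ∈ s, (inner ℂ (e i) x : ℂ) • e i‖ ≤ R := by
  classical
  have hs := he.hasSum_of_mem_closure_span hx
  refine le_of_tendsto (Filter.Tendsto.norm (Filter.Tendsto.sub_const hs _)) ?_
  filter_upwards [Filter.eventually_ge_atTop s] with t ht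
  rw [← Finset.sum_sdiff ht, add_sub_cancel_right]
  refine (sq_le_sq₀ (norm_nonneg _) hR).1 ?_
  have h1 := he.inner_sum (fun i => (inner ℂ (e i) x : ℂ)) (fun i => (inner ℂ (e i) x : ℂ)) (t \ s)
  rw [inner_self_eq_norm_sq_to_K] at h1
  have h2 : ‖∑ i ∈ t \ s, (inner ℂ (e i) x : ℂ) • e i‖ ^ 2 =
      ∑ i ∈ t \ s, ‖(inner ℂ (e i) x : ℂ)‖ ^ 2 := by
    have h3 : ∀ z : ℂ, conj z * z = ((‖z‖ ^ 2 : ℝ) : ℂ) := fun z => by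
      rw [Complex.conj_mul']; push_cast; rfl
    simp only [h3] at h1
    refine Complex.ofReal_injective ?_
    rw [Complex.ofReal_sum, ← h1, Complex.ofReal_pow]
    rfl
  rw [h2]
  exact h _ Finset.disjoint_sdiff

noncomputable section

namespace BlochPencil

/-! ### Integration over the cell and periodic integration by parts -/

theorem cell_ae_eq_Icc :
    cell =ᵐ[volume] Set.Icc (fun _ => -Real.pi : Plane) (fun _ => Real.pi) := by
  rw [volume_pi]
  exact Measure.univ_pi_Ioc_ae_eq_Icc

theorem cell_subset_Icc : cell ⊆ Set.Icc (fun _ => -Real.pi : Plane) (fun _ => Real.pi) :=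
  fun _ hx => ⟨fun j => (hx j trivial).1.le, fun j => (hx j trivial).2⟩

theorem measurableSet_cell : MeasurableSet cell :=
  MeasurableSet.univ_pi fun _ => measurableSet_Ioc

theorem volume_cell : volume cell = ENNReal.ofReal ((2 * Real.pi) ^ 2) := by
  rw [cell, Real.volume_pi_Ioc, Fin.prod_univ_two, ← ENNReal.ofReal_mul (by linarith [Real.pi_pos])]
  congr 1
  ring

instance : IsFiniteMeasure ((volume : Measure Plane).restrict cell) :=
  ⟨by rw [Measure.restrict_apply_univ, volume_cell]; exact ENNReal.ofReal_lt_top⟩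

theorem integrableOn_cell {f : Plane → ℂ} (hf : Continuous f) : IntegrableOn f cell :=
  (hf.continuousOn.integrableOn_Icc).mono_set cell_subset_Icc

theorem memLp_cell {f : Plane → ℂ} (hf : Continuous f) :
    MemLp f 2 ((volume : Measure Plane).restrict cell) := by
  obtain ⟨C, hC⟩ := (isCompact_Icc (a := (fun _ => -Real.pi : Plane))
    (b := fun _ => Real.pi)).exists_bound_of_continuousOn hf.continuousOn
  refine MemLp.of_bound hf.aestronglyMeasurable C ?_
  filter_upwards [ae_restrict_mem measurableSet_cell] with x hx
  exact hC x (cell_subset_Icc hx)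

namespace IsSmoothPeriodic

variable {φ ψ : Plane → ℂ}

theorem continuous (hφ : IsSmoothPeriodic φ) : Continuous φ := hφ.smooth.continuous

theorem differentiable (hφ : IsSmoothPeriodic φ) : Differentiable ℝ φ :=
  hφ.smooth.differentiable (by simp)

theorem continuous_partialDeriv (hφ : IsSmoothPeriodic φ) (j : Fin 2) :
    Continuous (partialDeriv j φ) :=
  (hφ.smooth.continuous_fderiv (by simp)).clm_apply continuous_const

theorem mul (hφ : IsSmoothPeriodic φ) (hψ : IsSmoothPeriodic ψ) :
    IsSmoothPeriodic fun x => φ x * ψ x :=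
  ⟨hφ.smooth.mul hψ.smooth, fun n x => by rw [hφ.periodic, hψ.periodic]⟩

theorem conjugate (hφ : IsSmoothPeriodic φ) : IsSmoothPeriodic fun x => conj (φ x) :=
  ⟨Complex.conjCLE.contDiff.comp hφ.smooth, fun n x => by rw [hφ.periodic]⟩

theorem partialDeriv_conj (hφ : IsSmoothPeriodic φ) (j : Fin 2) (x : Plane) :
    partialDeriv j (fun x => starRingEnd ℂ (φ x)) x = starRingEnd ℂ (partialDeriv j φ x) := by
  have h := (Complex.conjCLE.hasFDerivAt.comp x (hφ.differentiable x).hasFDerivAt).fderiv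
  exact congrArg (fun L : Plane →L[ℝ] ℂ => L (Pi.single j 1)) h

theorem partialDeriv_mul (hφ : IsSmoothPeriodic φ) (hψ : IsSmoothPeriodic ψ) (j : Fin 2)
    (x : Plane) : partialDeriv j (fun x => φ x * ψ x) x =
      φ x * partialDeriv j ψ x + ψ x * partialDeriv j φ x := by
  unfold partialDeriv
  rw [fderiv_fun_mul (hφ.differentiable x) (hψ.differentiable x)]
  rfl

/-- The divergence theorem for the field `φ eⱼ`: only the two faces orthogonal to `eⱼ` contribute,
and they cancel by periodicity. -/
theorem setIntegral_partialDeriv (hφ : IsSmoothPeriodic φ) (j : Fin 2) :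
    ∫ x in cell, partialDeriv j φ x = 0 := by
  rw [setIntegral_congr_set cell_ae_eq_Icc]
  have key := integral_divergence_of_hasFDerivAt_off_countable' (n := 1)
    (fun _ => -Real.pi) (fun _ => Real.pi) (fun _ => by linarith [Real.pi_pos])
    (fun i => if i = j then φ else 0) (fun i => if i = j then fderiv ℝ φ else 0) ∅
    Set.countable_empty
    (fun i => by split_ifs <;> [exact hφ.continuous.continuousOn; exact continuousOn_const])
    (fun x _ i => by
      split_ifs
      · exact (hφ.differentiable x).hasFDerivAt
      · exact hasFDerivAt_const 0 x)
  have hsum : ∀ x : Plane, ∑ i, (if i = j then fderiv ℝ φ else 0) x (Pi.single i 1) =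
      partialDeriv j φ x := by
    intro x
    rw [Finset.sum_eq_single j]
    · simp [partialDeriv]
    · intro i _ hi
      simp [hi]
    · simp
  simp only [hsum] at key
  rw [key (hφ.continuous_partialDeriv j).continuousOn.integrableOn_Icc]
  refine Finset.sum_eq_zero fun i _ => ?_
  split_ifs with hij
  · subst hij
    rw [sub_eq_zero]
    congr 1
    ext y
    -- The lattice vector `2π eᵢ` carries the face `xᵢ = -π` to the face `xᵢ = π`.
    have := hφ.periodic (Pi.single i 1) (i.insertNth (-Real.pi) y)
    rw [← this]
    congr 1
    ext l
    refine Fin.succAboveCases i ?_ (fun m => ?_) l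
    · simp [latticeVec]; ring
    · simp [latticeVec]
  · simp

theorem setIntegral_mul_partialDeriv (hφ : IsSmoothPeriodic φ) (hψ : IsSmoothPeriodic ψ)
    (j : Fin 2) :
    ∫ x in cell, φ x * partialDeriv j ψ x = -∫ x in cell, ψ x * partialDeriv j φ x := by
  have h := (hφ.mul hψ).setIntegral_partialDeriv j
  simp only [hφ.partialDeriv_mul hψ] at h
  refine eq_neg_of_add_eq_zero_left (Eq.trans ?_ h)
  exact (integral_add (integrableOn_cell (hφ.continuous.mul (hψ.continuous_partialDeriv j)))
    (integrableOn_cell (hψ.continuous.mul (hφ.continuous_partialDeriv j)))).symm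

/-- A smooth periodic function as an element of `H¹(𝕋²)`. -/
def toH1 (hφ : IsSmoothPeriodic φ) : H1 :=
  ⟨WithLp.toLp 2 ((memLp_cell hφ.continuous).toLp φ,
      WithLp.toLp 2 fun j => (memLp_cell (hφ.continuous_partialDeriv j)).toLp (partialDeriv j φ)),
    smoothJets.le_topologicalClosure
      ⟨φ, hφ, (memLp_cell hφ.continuous).coeFn_toLp,
        fun j => (memLp_cell (hφ.continuous_partialDeriv j)).coeFn_toLp⟩⟩

theorem val_toH1 (hφ : IsSmoothPeriodic φ) :
    val hφ.toH1 = (memLp_cell hφ.continuous).toLp φ := rfl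

theorem grad_toH1 (hφ : IsSmoothPeriodic φ) (j : Fin 2) :
    grad hφ.toH1 j = (memLp_cell (hφ.continuous_partialDeriv j)).toLp (partialDeriv j φ) := rfl

end IsSmoothPeriodic

/-! ### Density arguments in `H¹` -/

/-- The function part of an element of `H¹(𝕋²)`, as a bounded operator into `L²(𝕋²)`. -/
def valL : H1 →L[ℂ] L2 :=
  LinearMap.mkContinuous { toFun := val, map_add' := val_add, map_smul' := val_smul } 1
    fun u => by simpa using norm_val_le u

/-- A partial derivative, as a bounded operator from `H¹(𝕋²)` to `L²(𝕋²)`. -/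
def gradL (j : Fin 2) : H1 →L[ℂ] L2 :=
  LinearMap.mkContinuous
    { toFun := fun u => grad u j
      map_add' := fun u v => grad_add u v j
      map_smul' := fun c u => grad_smul c u j } 1
    fun u => by simpa using norm_grad_le u j

theorem valL_apply (u : H1) : valL u = val u := rfl

@[fun_prop]
theorem continuous_val : Continuous val := valL.continuous

@[fun_prop]
theorem continuous_grad (j : Fin 2) : Continuous fun u => grad u j := (gradL j).continuous

theorem H1.ext {u v : H1} (h : val u = val v) (h' : ∀ j, grad u j = grad v j) : u = v := by
  refine Subtype.ext ((WithLp.ofLp_injective 2) (Prod.ext h ?_))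
  exact PiLp.ext h'

/-- Closed properties that hold for smooth periodic functions hold on all of `H¹(𝕋²)`. -/
theorem H1.induction {p : H1 → Prop} (hp : IsClosed {u | p u})
    (h : ∀ (φ : Plane → ℂ) (hφ : IsSmoothPeriodic φ), p hφ.toH1) (u : H1) : p u := by
  obtain ⟨w, hw⟩ := u
  have hs : ∀ (w) (hw : w ∈ smoothJets), p ⟨w, smoothJets.le_topologicalClosure hw⟩ := by
    rintro w ⟨φ, hφ, h1, h2⟩
    refine (congrArg p (H1.ext (Lp.ext ?_) fun j => Lp.ext ?_)).mpr (h φ hφ)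
    · exact h1.trans (memLp_cell hφ.continuous).coeFn_toLp.symm
    · exact (h2 j).trans (memLp_cell (hφ.continuous_partialDeriv j)).coeFn_toLp.symm
  have hd : DenseRange (Set.inclusion (smoothJets.le_topologicalClosure) :
      smoothJets → smoothJets.topologicalClosure) :=
    (denseRange_inclusion_iff _).2 subset_rfl
  exact hd.induction_on (p := fun u : smoothJets.topologicalClosure => p u)
    (⟨w, hw⟩ : smoothJets.topologicalClosure) hp fun a => hs a.1 a.2

theorem inner_L2_eq (f g : L2) : (inner ℂ f g : ℂ) = ∫ x in cell, conj (f x) * g x := by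
  rw [L2.inner_def]
  simp only [RCLike.inner_apply, mul_comm]

theorem inner_toLp {f g : Plane → ℂ} (hf : MemLp f 2 ((volume : Measure Plane).restrict cell))
    (hg : MemLp g 2 ((volume : Measure Plane).restrict cell)) :
    (inner ℂ (hf.toLp f) (hg.toLp g) : ℂ) = ∫ x in cell, conj (f x) * g x := by
  rw [inner_L2_eq]
  refine integral_congr_ae ?_
  filter_upwards [hf.coeFn_toLp, hg.coeFn_toLp] with x h1 h2
  rw [h1, h2]

/-- Integration by parts in `H¹(𝕋²)`. -/
theorem inner_val_grad (u v : H1) (j : Fin 2) :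
    (inner ℂ (val u) (grad v j) : ℂ) = -inner ℂ (grad u j) (val v) := by
  induction u using H1.induction with
  | hp => exact isClosed_eq (by fun_prop) (by fun_prop)
  | h φ hφ =>
    induction v using H1.induction with
    | hp => exact isClosed_eq (by fun_prop) (by fun_prop)
    | h ψ hψ =>
      simp only [IsSmoothPeriodic.val_toH1, IsSmoothPeriodic.grad_toH1, inner_toLp]
      -- The smooth identity is applied to `φ̄`, because the inner product conjugates its first
      -- argument.
      rw [hφ.conjugate.setIntegral_mul_partialDeriv hψ]
      simp only [hφ.partialDeriv_conj, mul_comm]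

/-! ### Plane waves and Fourier coefficients -/

/-- The normalised plane wave `(2π)⁻¹ exp(i n · x)`. -/
def planeWave (n : Fin 2 → ℤ) (x : Plane) : ℂ :=
  (2 * Real.pi : ℂ)⁻¹ * Complex.exp (Complex.I * ∑ j, (n j : ℂ) * (x j : ℂ))

theorem planeWave_smoothPeriodic (n : Fin 2 → ℤ) : IsSmoothPeriodic (planeWave n) where
  smooth := by
    unfold planeWave
    have h : ∀ j : Fin 2, ContDiff ℝ ((⊤ : ℕ∞) : WithTop ℕ∞) fun x : Plane => ((x j : ℝ) : ℂ) :=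
      fun j => Complex.ofRealCLM.contDiff.comp (contDiff_apply ℝ ℝ j)
    fun_prop
  periodic m x := by
    unfold planeWave
    congr 1
    rw [Complex.exp_eq_exp_iff_exists_int]
    -- Translation by `2π m` adds `2πi (n · m)` to the exponent.
    refine ⟨∑ j, n j * m j, ?_⟩
    simp only [latticeVec, Fin.sum_univ_two, Pi.add_apply]
    push_cast
    ring

theorem partialDeriv_planeWave (n : Fin 2 → ℤ) (j : Fin 2) (x : Plane) :
    partialDeriv j (planeWave n) x = Complex.I * n j * planeWave n x := by
  have h : ∀ i : Fin 2, HasFDerivAt (fun x : Plane => ((x i : ℝ) : ℂ))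
      (Complex.ofRealCLM.comp (ContinuousLinearMap.proj i)) x :=
    fun i => (Complex.ofRealCLM.comp (ContinuousLinearMap.proj (R := ℝ)
      (φ := fun _ : Fin 2 => ℝ) i)).hasFDerivAt
  have h2 := (((HasFDerivAt.fun_sum (u := Finset.univ)
    fun i _ => (h i).const_mul (n i : ℂ)).const_mul Complex.I).cexp.const_mul
      (2 * Real.pi : ℂ)⁻¹).fderiv
  unfold partialDeriv planeWave
  rw [h2]
  fin_cases j <;> simp [Fin.sum_univ_two] <;> ring

/-- Plane waves as elements of `H¹(𝕋²)`. -/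
def waveH1 (n : Fin 2 → ℤ) : H1 := (planeWave_smoothPeriodic n).toH1

theorem grad_waveH1 (n : Fin 2 → ℤ) (j : Fin 2) :
    grad (waveH1 n) j = (Complex.I * n j) • val (waveH1 n) := by
  refine Lp.ext ?_
  rw [waveH1, IsSmoothPeriodic.grad_toH1, IsSmoothPeriodic.val_toH1]
  refine (MemLp.coeFn_toLp _).trans ?_
  filter_upwards [Lp.coeFn_smul (Complex.I * n j)
    ((memLp_cell (planeWave_smoothPeriodic n).continuous).toLp (planeWave n)),
    (memLp_cell (planeWave_smoothPeriodic n).continuous).coeFn_toLp] with x h1 h2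
  rw [h1, Pi.smul_apply, h2, partialDeriv_planeWave, smul_eq_mul]

/-- The Fourier coefficients of a derivative. -/
theorem inner_wave_grad (n : Fin 2 → ℤ) (u : H1) (j : Fin 2) :
    (inner ℂ (val (waveH1 n)) (grad u j) : ℂ) =
      Complex.I * n j * inner ℂ (val (waveH1 n)) (val u) := by
  rw [inner_val_grad, grad_waveH1, inner_smul_left]
  simp

/-- The factor `(2π)⁻¹` compensates the area `(2π)²` of the cell. Orthogonality needs no integral:
the waves are eigenvectors of the skew-symmetric operators `∂ⱼ`, with distinct eigenvalues `i nⱼ ≠ i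
mⱼ` for some `j`. -/
theorem orthonormal_wave : Orthonormal ℂ fun n : Fin 2 → ℤ => val (waveH1 n) := by
  constructor
  · intro n
    have h : (inner ℂ (val (waveH1 n)) (val (waveH1 n)) : ℂ) = 1 := by
      rw [waveH1, IsSmoothPeriodic.val_toH1, inner_toLp]
      have h1 : ∀ x, conj (planeWave n x) * planeWave n x = (((2 * Real.pi) ^ 2)⁻¹ : ℝ) := by
        intro x
        have h2 : ∑ j, (n j : ℂ) * (x j : ℂ) = ((∑ j, (n j : ℝ) * x j : ℝ) : ℂ) := by
          push_cast
          rfl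
        rw [Complex.conj_mul', planeWave, norm_mul, norm_inv, h2, mul_comm Complex.I,
          Complex.norm_exp_ofReal_mul_I]
        simp [abs_of_pos Real.pi_pos, mul_pow, mul_comm]
      simp only [h1, setIntegral_const, Measure.real, volume_cell]
      rw [ENNReal.toReal_ofReal (by positivity), Complex.real_smul, ← Complex.ofReal_mul,
        mul_inv_cancel₀ (by positivity), Complex.ofReal_one]
    rw [inner_self_eq_norm_sq_to_K] at h
    have h2 : ‖val (waveH1 n)‖ ^ 2 = 1 := Complex.ofReal_injective (by
      rw [Complex.ofReal_pow, Complex.ofReal_one]; exact h)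
    nlinarith [norm_nonneg (val (waveH1 n))]
  · intro n m hnm
    obtain ⟨j, hj⟩ := Function.ne_iff.1 hnm
    have h := inner_wave_grad n (waveH1 m) j
    rw [grad_waveH1, inner_smul_right] at h
    have h2 : (Complex.I * ((m j : ℂ) - n j)) * inner ℂ (val (waveH1 n)) (val (waveH1 m)) = 0 := by
      linear_combination h
    refine (mul_eq_zero.1 h2).resolve_left (mul_ne_zero Complex.I_ne_zero ?_)
    rw [sub_ne_zero]
    exact_mod_cast hj.symm

/-! ### Completeness of the plane waves -/

/-- The quotient map from the plane onto the torus. -/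
def toTorus : C(Plane, UnitAddTorus (Fin 2)) where
  toFun x j := ((x j / (2 * Real.pi) : ℝ) : UnitAddCircle)
  continuous_toFun := continuous_pi fun j =>
    (AddCircle.continuous_mk' 1).comp ((continuous_apply j).div_const _)

theorem toTorus_apply (x : Plane) (j : Fin 2) :
    toTorus x j = ((x j / (2 * Real.pi) : ℝ) : UnitAddCircle) := rfl

/-- This lets continuous periodic functions descend to the torus. Openness is carried through the
proof because products preserve open quotient maps, but not quotient maps in general. -/
theorem isQuotientMap_toTorus : Topology.IsQuotientMap toTorus := by
  have hpi : (2 * Real.pi) ≠ 0 := by positivity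
  have h : IsOpenQuotientMap fun t : ℝ => ((t / (2 * Real.pi) : ℝ) : UnitAddCircle) :=
    IsOpenQuotientMap.comp (g := ((↑) : ℝ → UnitAddCircle)) QuotientAddGroup.isOpenQuotientMap_mk
      ((Homeomorph.mulRight₀ _ (inv_ne_zero hpi)).isOpenQuotientMap)
  exact (IsOpenQuotientMap.piMap fun _ : Fin 2 => h).isQuotientMap

theorem exists_int_of_toTorus_eq {x y : Plane} (h : toTorus x = toTorus y) :
    ∃ m : Fin 2 → ℤ, x = y + latticeVec m := by
  have h' : ∀ j, ∃ m : ℤ, x j = y j + 2 * Real.pi * m := by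
    intro j
    have h1 := congrFun h j
    rw [toTorus_apply, toTorus_apply, ← sub_eq_zero, ← AddCircle.coe_sub,
      AddCircle.coe_eq_zero_iff] at h1
    obtain ⟨m, hm⟩ := h1
    refine ⟨m, ?_⟩
    have hpi := Real.pi_ne_zero
    rw [zsmul_eq_mul, mul_one] at hm
    rw [hm]
    field_simp
    ring
  choose m hm using h'
  exact ⟨m, funext hm⟩

theorem mFourier_toTorus (n : Fin 2 → ℤ) (x : Plane) :
    UnitAddTorus.mFourier n (toTorus x) = 2 * Real.pi * planeWave n x := by
  rw [planeWave, mul_inv_cancel_left₀ (by simp)]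
  simp only [UnitAddTorus.mFourier, ContinuousMap.coe_mk, toTorus_apply, fourier_coe_apply,
    Fin.prod_univ_two, Fin.sum_univ_two, ← Complex.exp_add]
  congr 1
  push_cast
  field_simp

/-- Continuous functions on the torus as elements of `L²(𝕋²)`. -/
def torusToL2 : C(UnitAddTorus (Fin 2), ℂ) →L[ℂ] L2 :=
  LinearMap.mkContinuousOfExistsBound
    { toFun := fun F => (memLp_cell ((F.comp toTorus).continuous)).toLp _
      map_add' := fun _ _ => rfl
      map_smul' := fun _ _ => rfl }
    (by
      refine ⟨_, fun F => Lp.norm_le_of_ae_bound (μ := (volume : Measure Plane).restrict cell)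
        (norm_nonneg F) ?_⟩
      refine (MemLp.coeFn_toLp (memLp_cell (F.comp toTorus).continuous)).mono fun x hx => ?_
      exact (congrArg norm hx).trans_le (F.norm_coe_le_norm (toTorus x)))

/-- Trigonometric polynomials are uniformly dense in the continuous functions on the torus, and
uniform convergence implies convergence in `L²` of the cell. A smooth periodic function descends to
the torus, and density of these functions in `H¹` does the rest. -/
theorem val_mem_closure_wave (u : H1) :
    val u ∈ (Submodule.span ℂ (Set.range fun n => val (waveH1 n))).topologicalClosure := by
  induction u using H1.induction with
  | hp => exact (Submodule.isClosed_topologicalClosure _).preimage continuous_val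
  | h φ hφ =>
    set W := (Submodule.span ℂ (Set.range fun n => val (waveH1 n))).topologicalClosure with hW
    have hle : (⊤ : Submodule ℂ C(UnitAddTorus (Fin 2), ℂ)) ≤ W.comap torusToL2.toLinearMap := by
      rw [← UnitAddTorus.span_mFourier_closure_eq_top]
      refine Submodule.topologicalClosure_minimal _ ?_
        ((Submodule.isClosed_topologicalClosure _).preimage torusToL2.continuous)
      rw [Submodule.span_le]
      rintro _ ⟨n, rfl⟩
      have : torusToL2 (UnitAddTorus.mFourier n) = (2 * Real.pi : ℂ) • val (waveH1 n) := by
        refine Eq.trans ?_ (MemLp.toLp_const_smul (2 * Real.pi : ℂ)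
          (memLp_cell (planeWave_smoothPeriodic n).continuous))
        exact MemLp.toLp_congr (memLp_cell ((UnitAddTorus.mFourier n).comp toTorus).continuous) _
          (Filter.Eventually.of_forall fun x => mFourier_toTorus n x)
      change torusToL2 (UnitAddTorus.mFourier n) ∈ W
      rw [this]
      exact W.smul_mem _ (Submodule.le_topologicalClosure _ (Submodule.subset_span ⟨n, rfl⟩))
    have hlift : Function.FactorsThrough (⟨φ, hφ.continuous⟩ : C(Plane, ℂ)) toTorus := by
      intro x y hxy
      obtain ⟨m, rfl⟩ := exists_int_of_toTorus_eq hxy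
      exact hφ.periodic m y
    let F : C(UnitAddTorus (Fin 2), ℂ) :=
      isQuotientMap_toTorus.lift ⟨φ, hφ.continuous⟩ hlift
    have hF : torusToL2 F = val hφ.toH1 := by
      refine MemLp.toLp_congr (memLp_cell (F.comp toTorus).continuous) (memLp_cell hφ.continuous)
        (Filter.Eventually.of_forall fun x => ?_)
      exact DFunLike.congr_fun (isQuotientMap_toTorus.lift_comp ⟨φ, hφ.continuous⟩ hlift) x
    rw [← hF]
    exact hle (Submodule.mem_top (x := F))

/-! ### Rellich's theorem -/

/-- Bessel's inequality for each `∂ⱼu`, whose coefficients are `i nⱼ` times those of `u`. -/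
theorem sum_sq_wave_le (u : H1) (t : Finset (Fin 2 → ℤ)) :
    ∑ n ∈ t, ((n 0 : ℝ) ^ 2 + (n 1 : ℝ) ^ 2) * ‖(inner ℂ (val (waveH1 n)) (val u) : ℂ)‖ ^ 2 ≤
      ‖u‖ ^ 2 := by
  have h : ∀ j : Fin 2, ∑ n ∈ t, (n j : ℝ) ^ 2 * ‖(inner ℂ (val (waveH1 n)) (val u) : ℂ)‖ ^ 2 ≤
      ‖grad u j‖ ^ 2 := by
    intro j
    refine le_trans (le_of_eq (Finset.sum_congr rfl fun n _ => ?_))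
      (orthonormal_wave.sum_inner_products_le (grad u j) (s := t))
    rw [inner_wave_grad, norm_mul, norm_mul, Complex.norm_I, Complex.norm_intCast]
    rw [one_mul, mul_pow, sq_abs]
  have h1 : ‖u‖ ^ 2 = ‖val u‖ ^ 2 + ‖(jet u).snd‖ ^ 2 := WithLp.prod_norm_sq_eq_of_L2 (jet u)
  have h2 : ‖(jet u).snd‖ ^ 2 = ∑ j, ‖grad u j‖ ^ 2 := PiLp.norm_sq_eq_of_L2 _ (jet u).snd
  rw [Fin.sum_univ_two] at h2
  simp only [add_mul, Finset.sum_add_distrib]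
  nlinarith [h 0, h 1, sq_nonneg ‖val u‖]

/-- Outside the box some `|nⱼ| ≥ N + 1`, so the weight in `sum_sq_wave_le` is at least `(N + 1)²` on
every tail. -/
theorem norm_val_sub_sum_le (u : H1) (N : ℕ) :
    ‖val u - ∑ n ∈ Finset.Icc (fun _ : Fin 2 => -(N : ℤ)) (fun _ => (N : ℤ)),
      (inner ℂ (val (waveH1 n)) (val u) : ℂ) • val (waveH1 n)‖ ≤ ‖u‖ / (N + 1) := by
  refine orthonormal_wave.norm_sub_sum_le (val_mem_closure_wave u) _ (by positivity) fun t ht => ?_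
  rw [div_pow, le_div_iff₀ (by positivity), Finset.sum_mul]
  refine le_trans (Finset.sum_le_sum fun n hn => ?_) (sum_sq_wave_le u t)
  rw [mul_comm]
  refine mul_le_mul_of_nonneg_right ?_ (sq_nonneg _)
  have hn' : n ∉ Finset.Icc (fun _ : Fin 2 => -(N : ℤ)) (fun _ => (N : ℤ)) :=
    fun h => Finset.disjoint_left.1 ht h hn
  have h3 : ∃ j, (N : ℤ) + 1 ≤ |n j| := by
    by_contra! h
    refine hn' (Finset.mem_Icc.2 ⟨fun j => ?_, fun j => ?_⟩)
    · have := abs_lt.1 (h j)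
      change -(N : ℤ) ≤ n j
      omega
    · have := abs_lt.1 (h j)
      change n j ≤ N
      omega
  obtain ⟨j, hj⟩ := h3
  have h4 : ((N : ℝ) + 1) ^ 2 ≤ (n j : ℝ) ^ 2 := by
    rw [← sq_abs (n j : ℝ)]
    have : ((N : ℝ) + 1) ≤ |(n j : ℝ)| := by exact_mod_cast hj
    gcongr
  fin_cases j
  · exact h4.trans (le_add_of_nonneg_right (sq_nonneg _))
  · exact h4.trans (le_add_of_nonneg_left (sq_nonneg _))

/-- **Rellich's theorem** on the torus: `H¹(𝕋²)` is compactly embedded in `L²(𝕋²)`. -/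
theorem isCompactOperator_valL : IsCompactOperator valL := by
  -- The Fourier truncations have finite rank, and compactness survives limits in operator norm.
  let P (N : ℕ) : H1 →L[ℂ] L2 :=
    ∑ n ∈ Finset.Icc (fun _ : Fin 2 => -(N : ℤ)) (fun _ => (N : ℤ)),
      ((innerSL ℂ (val (waveH1 n))).comp valL).smulRight (val (waveH1 n))
  have hP : ∀ N, IsCompactOperator (P N) := by
    intro N
    refine Submodule.sum_mem (compactOperator (RingHom.id ℂ) H1 L2) fun n _ => ?_
    have h : IsCompactOperator ((innerSL ℂ (val (waveH1 n))).comp valL) :=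
      isCompactOperator_of_locallyCompactSpace_dom _
    exact h.clm_comp (ContinuousLinearMap.toSpanSingleton ℂ (val (waveH1 n)))
  refine isCompactOperator_of_tendsto (l := Filter.atTop) (F := P) ?_
    (Filter.Eventually.of_forall hP)
  rw [tendsto_iff_norm_sub_tendsto_zero]
  refine squeeze_zero (fun _ => norm_nonneg _) (fun N => ?_)
    (tendsto_one_div_add_atTop_nhds_zero_nat (𝕜 := ℝ))
  refine ContinuousLinearMap.opNorm_le_bound _ (by positivity) fun u => ?_
  rw [← norm_neg, one_div_mul_eq_div]
  refine le_trans (le_of_eq (congrArg _ ?_)) (norm_val_sub_sum_le u N)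
  simp [P, valL_apply]

/-! ### The three forms through inner products, and their Hermitian symmetry -/

theorem inner_H1_eq (v u : H1) : (inner ℂ v u : ℂ) =
    inner ℂ (val v) (val u) + ∑ j, inner ℂ (grad v j) (grad u j) := by
  have h : (inner ℂ v u : ℂ) = inner ℂ (jet v).fst (jet u).fst + inner ℂ (jet v).snd (jet u).snd :=
    WithLp.prod_inner_apply (jet v) (jet u)
  rw [h, PiLp.inner_apply]
  rfl

/-- This isolates the identity in `A₀`: what remains involves no derivatives. -/
theorem form0_eq {ε : Plane → ℝ → ℝ} {ω₀ ω₁ : ℝ} (hε : IsPermittivity ε ω₀ ω₁) {ω : ℝ}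
    (hω : ω ∈ Set.Icc ω₀ ω₁) (u v : H1) : form0 ε ω u v =
      inner ℂ v u - inner ℂ (val v) (val u) +
        weighted (fun x => -((ω : ℂ) ^ 2 * (ε x ω : ℂ))) (val u) (val v) := by
  have h1 := isWeight_const 1
  have hw := isWeight_permittivity hε hω
  have h : ∀ f g : L2, (inner ℂ g f : ℂ) = weighted (fun _ => 1) f g := fun f g => by
    rw [inner_L2_eq]
    simp only [weighted, one_mul, mul_comm]
  rw [inner_H1_eq, add_sub_cancel_left, Fin.sum_univ_two, h, h]
  unfold weighted form0
  rw [← integral_add (integrable_weighted h1 _ _) (integrable_weighted h1 _ _)]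
  refine Eq.trans ?_ (integral_add ((integrable_weighted h1 _ _).add (integrable_weighted h1 _ _))
    (integrable_weighted hw _ _))
  refine integral_congr_ae (Filter.Eventually.of_forall fun x => ?_)
  simp only [Fin.sum_univ_two]
  ring

theorem form1_eq (k : EuclideanSpace ℝ (Fin 2)) (u v : H1) :
    form1 k u v = 2 * Complex.I * ∑ j, (k j : ℂ) * inner ℂ (grad v j) (val u) := by
  have h : ∀ j, ∀ f g : L2, (k j : ℂ) * (inner ℂ g f : ℂ) = weighted (fun _ => k j) f g :=
    fun j f g => by
      rw [inner_L2_eq, ← integral_const_mul]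
      simp only [weighted, mul_comm]
  rw [form1, Fin.sum_univ_two, h, h]
  congr 1
  refine Eq.trans ?_ (integral_add (integrable_weighted (isWeight_const _) _ _)
    (integrable_weighted (isWeight_const _) _ _))
  refine integral_congr_ae (Filter.Eventually.of_forall fun x => ?_)
  simp only [Fin.sum_univ_two]
  ring

theorem form2_eq (u v : H1) : form2 u v = inner ℂ (val v) (val u) := by
  rw [inner_L2_eq]
  simp only [form2, mul_comm]

theorem conj_form0 (ε : Plane → ℝ → ℝ) (ω : ℝ) (u v : H1) :
    conj (form0 ε ω v u) = form0 ε ω u v := by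
  unfold form0
  rw [← integral_conj]
  refine integral_congr_ae (Filter.Eventually.of_forall fun x => ?_)
  simp only [Fin.sum_univ_two, map_sub, map_add, map_mul, map_pow, Complex.conj_conj,
    Complex.conj_ofReal]
  ring

/-- Integration by parts makes `k̂ · ∇` skew-symmetric, and the factor `i` turns it into a Hermitian
form. -/
theorem conj_form1 (k : EuclideanSpace ℝ (Fin 2)) (u v : H1) :
    conj (form1 k v u) = form1 k u v := by
  simp only [form1_eq, Fin.sum_univ_two, map_mul, map_add, Complex.conj_ofReal, Complex.conj_I,
    inner_conj_symm, inner_val_grad, map_ofNat]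
  ring

theorem conj_form2 (u v : H1) : conj (form2 v u) = form2 u v := by
  simp only [form2_eq, inner_conj_symm]

/-! ### The pencil as a compact perturbation of the identity, and its adjoint -/

section Pencil

variable {ε : Plane → ℝ → ℝ} {ω₀ ω₁ : ℝ} (hε : IsPermittivity ε ω₀ ω₁) {ω : ℝ}
  (hω : ω ∈ Set.Icc ω₀ ω₁) (k : EuclideanSpace ℝ (Fin 2)) (z : ℂ)

theorem inner_pencil (u v : H1) : (inner ℂ v (pencil hε hω k z u) : ℂ) =
    form0 ε ω u v + z * form1 k u v + z ^ 2 * form2 u v := by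
  have h : pencil hε hω k z u = opA0 hε hω u + z • opA1 k u + z ^ 2 • opA2 u := rfl
  rw [h, inner_add_right, inner_add_right, inner_smul_right, inner_smul_right, opA0, opA1, opA2,
    inner_riesz, inner_riesz, inner_riesz]

theorem adjoint_pencil :
    ContinuousLinearMap.adjoint (pencil hε hω k z) = pencil hε hω k (conj z) := by
  refine ((ContinuousLinearMap.eq_adjoint_iff _ _).2 fun u v => ?_).symm
  rw [← inner_conj_symm, inner_pencil, inner_pencil]
  simp only [map_add, map_mul, map_pow, Complex.conj_conj, conj_form0, conj_form1, conj_form2]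

/-- `1 - Q(z)` is of lower order. -/
theorem exists_norm_one_sub_pencil_le :
    ∃ C : ℝ, ∀ u, ‖(1 - pencil hε hω k z) u‖ ≤ C * ‖valL u‖ := by
  obtain ⟨C, hC0, hC⟩ := weighted_bound (isWeight_permittivity hε hω)
  -- The summands bound, in turn, the term `∫ u v̄` that `a₀` lacks compared with the `H¹` product,
  -- the permittivity term, `z a₁` and `z² a₂`.
  refine ⟨1 + C + ‖z‖ * (2 * (‖(k 0 : ℂ)‖ + ‖(k 1 : ℂ)‖)) + ‖z‖ ^ 2, fun u => ?_⟩
  rw [valL_apply]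
  -- With `v = (1 - Q(z))u` as test vector, `‖v‖²` is a sum of terms each at most a constant times
  -- `‖val u‖ * ‖v‖`. One factor `‖v‖` is cancelled at the end.
  generalize hv : (1 - pencil hε hω k z) u = v
  have h1 : ((‖v‖ ^ 2 : ℝ) : ℂ) = inner ℂ (val v) (val u) -
      weighted (fun x => -((ω : ℂ) ^ 2 * (ε x ω : ℂ))) (val u) (val v)
      - z * form1 k u v - z ^ 2 * inner ℂ (val v) (val u) := by
    have h2 : (inner ℂ v v : ℂ) = inner ℂ v u - inner ℂ v (pencil hε hω k z u) := by
      rw [← inner_sub_right]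
      exact congrArg _ hv.symm
    rw [inner_pencil, form0_eq hε hω, form2_eq] at h2
    have h3 : (inner ℂ v v : ℂ) = ((‖v‖ ^ 2 : ℝ) : ℂ) := by
      rw [inner_self_eq_norm_sq_to_K, Complex.ofReal_pow]
      rfl
    rw [← h3, h2]
    ring
  have hi : ‖(inner ℂ (val v) (val u) : ℂ)‖ ≤ ‖val u‖ * ‖v‖ := by
    refine (norm_inner_le_norm _ _).trans ?_
    rw [mul_comm]
    gcongr
    exact norm_val_le v
  have hg : ∀ j, ‖(inner ℂ (grad v j) (val u) : ℂ)‖ ≤ ‖val u‖ * ‖v‖ := fun j => by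
    refine (norm_inner_le_norm _ _).trans ?_
    rw [mul_comm]
    gcongr
    exact norm_grad_le v j
  have hw : ‖weighted (fun x => -((ω : ℂ) ^ 2 * (ε x ω : ℂ))) (val u) (val v)‖ ≤
      C * (‖val u‖ * ‖v‖) := by
    refine (hC _ _).trans ?_
    rw [mul_assoc]
    gcongr
    exact norm_val_le v
  have hf : ‖form1 k u v‖ ≤ 2 * (‖(k 0 : ℂ)‖ + ‖(k 1 : ℂ)‖) * (‖val u‖ * ‖v‖) := by
    rw [form1_eq, norm_mul, norm_mul, Complex.norm_I, Complex.norm_ofNat, mul_one, mul_assoc,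
      Fin.sum_univ_two]
    gcongr
    refine (norm_add_le _ _).trans ?_
    rw [norm_mul, norm_mul, add_mul]
    gcongr
    · exact hg 0
    · exact hg 1
  have h4 : ‖v‖ * ‖v‖ ≤ (1 + C + ‖z‖ * (2 * (‖(k 0 : ℂ)‖ + ‖(k 1 : ℂ)‖)) + ‖z‖ ^ 2) *
      ‖val u‖ * ‖v‖ := by
    calc ‖v‖ * ‖v‖ = ‖((‖v‖ ^ 2 : ℝ) : ℂ)‖ := by
          rw [Complex.norm_real, Real.norm_of_nonneg (by positivity), sq]
      _ ≤ ‖val u‖ * ‖v‖ + C * (‖val u‖ * ‖v‖) +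
          ‖z‖ * (2 * (‖(k 0 : ℂ)‖ + ‖(k 1 : ℂ)‖) * (‖val u‖ * ‖v‖)) +
          ‖z‖ ^ 2 * (‖val u‖ * ‖v‖) := by
        rw [h1]
        refine norm_sub_le_of_le (norm_sub_le_of_le (norm_sub_le_of_le hi hw) ?_) ?_
        · rw [norm_mul]
          gcongr
        · rw [norm_mul, norm_pow]
          gcongr
      _ = _ := by ring
  rcases (norm_nonneg v).eq_or_lt with h0 | h0
  · rw [← h0]
    positivity
  · exact le_of_mul_le_mul_right h4 h0

theorem isCompactOperator_one_sub_pencil :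
    IsCompactOperator (1 - pencil hε hω k z : H1 →L[ℂ] H1) := by
  obtain ⟨C, hC⟩ := exists_norm_one_sub_pencil_le hε hω k z
  exact isCompactOperator_valL.of_norm_le hC

theorem pencilSpectrum_eq_pencilEigenvalues :
    pencilSpectrum (pencil hε hω k) = pencilEigenvalues (pencil hε hω k) :=
  Set.ext fun z => (ContinuousLinearMap.fredholm_alternative
    (isCompactOperator_one_sub_pencil hε hω k z)).1

theorem conj_mem_pencilSpectrum {z : ℂ} (hz : z ∈ pencilSpectrum (pencil hε hω k)) :
    conj z ∈ pencilSpectrum (pencil hε hω k) := by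
  intro h
  refine hz ?_
  have h2 := h.star
  rwa [ContinuousLinearMap.star_eq_adjoint, adjoint_pencil, Complex.conj_conj] at h2

end Pencil

/-! ### Complex conjugation and the reflection of the spectrum in the imaginary axis -/

/-- Complex conjugation on `L²(𝕋²)`. -/
def conjL2 : L2 →L[ℝ] L2 :=
  ContinuousLinearMap.compLpL 2 ((volume : Measure Plane).restrict cell)
    (Complex.conjCLE : ℂ →L[ℝ] ℂ)

theorem coeFn_conjL2 (f : L2) :
    conjL2 f =ᵐ[(volume : Measure Plane).restrict cell] fun x => conj (f x) :=
  ContinuousLinearMap.coeFn_compLpL _ f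

theorem conjL2_conjL2 (f : L2) : conjL2 (conjL2 f) = f := by
  refine Lp.ext ?_
  filter_upwards [coeFn_conjL2 (conjL2 f), coeFn_conjL2 f] with x h1 h2
  rw [h1, h2, Complex.conj_conj]

/-- Complex conjugation of pairs (function, vector field). -/
def conjJet (w : Jet) : Jet := WithLp.toLp 2 (conjL2 w.fst, WithLp.toLp 2 fun j => conjL2 (w.snd j))

theorem continuous_conjJet : Continuous conjJet := by
  unfold conjJet
  refine (WithLp.prod_continuous_toLp 2 _ _).comp (Continuous.prodMk ?_ ?_)
  · exact conjL2.continuous.comp (continuous_fst.comp (WithLp.prod_continuous_ofLp 2 _ _))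
  · refine (PiLp.continuous_toLp 2 _).comp (continuous_pi fun j => conjL2.continuous.comp ?_)
    exact (continuous_apply j).comp ((PiLp.continuous_ofLp 2 _).comp
      (continuous_snd.comp (WithLp.prod_continuous_ofLp 2 _ _)))

theorem conjJet_mem_smoothJets {w : Jet} (hw : w ∈ smoothJets) : conjJet w ∈ smoothJets := by
  obtain ⟨φ, hφ, h1, h2⟩ := hw
  refine ⟨_, hφ.conjugate, ?_, fun j => ?_⟩
  · filter_upwards [coeFn_conjL2 w.fst, h1] with x h3 h4
    rw [← h4]
    exact h3
  · filter_upwards [coeFn_conjL2 (w.snd j), h2 j] with x h3 h4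
    rw [hφ.partialDeriv_conj, ← h4]
    exact h3

/-- Complex conjugation on `H¹(𝕋²)`. -/
def conjH1 (u : H1) : H1 :=
  ⟨conjJet (jet u), map_mem_closure continuous_conjJet u.2 fun _ => conjJet_mem_smoothJets⟩

theorem val_conjH1 (u : H1) : val (conjH1 u) = conjL2 (val u) := rfl

theorem grad_conjH1 (u : H1) (j : Fin 2) : grad (conjH1 u) j = conjL2 (grad u j) := rfl

theorem conjH1_conjH1 (u : H1) : conjH1 (conjH1 u) = u :=
  H1.ext (conjL2_conjL2 _) fun _ => conjL2_conjL2 _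

theorem inner_conjL2 (f g : L2) : (inner ℂ (conjL2 f) (conjL2 g) : ℂ) = conj (inner ℂ f g) := by
  rw [inner_L2_eq, inner_L2_eq, ← integral_conj]
  refine integral_congr_ae ?_
  filter_upwards [coeFn_conjL2 f, coeFn_conjL2 g] with x h1 h2
  rw [h1, h2, map_mul]

theorem form0_conjH1 (ε : Plane → ℝ → ℝ) (ω : ℝ) (u v : H1) :
    form0 ε ω (conjH1 u) (conjH1 v) = conj (form0 ε ω u v) := by
  unfold form0
  rw [← integral_conj]
  refine integral_congr_ae ?_
  simp only [val_conjH1, grad_conjH1, Fin.sum_univ_two]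
  filter_upwards [coeFn_conjL2 (val u), coeFn_conjL2 (val v), coeFn_conjL2 (grad u 0),
    coeFn_conjL2 (grad v 0), coeFn_conjL2 (grad u 1), coeFn_conjL2 (grad v 1)]
    with x h1 h2 h3 h4 h5 h6
  rw [h1, h2, h3, h4, h5, h6]
  simp only [map_sub, map_add, map_mul, map_pow, Complex.conj_ofReal]

/-- Since `k` is real, the sign comes only from the prefactor `2i`. -/
theorem form1_conjH1 (k : EuclideanSpace ℝ (Fin 2)) (u v : H1) :
    form1 k (conjH1 u) (conjH1 v) = -conj (form1 k u v) := by
  simp only [form1_eq, val_conjH1, grad_conjH1, inner_conjL2, Fin.sum_univ_two, map_mul, map_add,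
    Complex.conj_ofReal, Complex.conj_I, map_ofNat]
  ring

theorem form2_conjH1 (u v : H1) : form2 (conjH1 u) (conjH1 v) = conj (form2 u v) := by
  simp only [form2_eq, val_conjH1, inner_conjL2]

/-- The sign change of `a₁` under conjugation is absorbed by passing from `z̄` to `-z̄`, which
leaves the square unchanged. -/
theorem pencil_conjH1 {ε : Plane → ℝ → ℝ} {ω₀ ω₁ : ℝ} (hε : IsPermittivity ε ω₀ ω₁) {ω : ℝ}
    (hω : ω ∈ Set.Icc ω₀ ω₁) (k : EuclideanSpace ℝ (Fin 2)) {z : ℂ} {u : H1}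
    (hu : pencil hε hω k z u = 0) : pencil hε hω k (-conj z) (conjH1 u) = 0 := by
  refine ext_inner_left ℂ fun v => ?_
  have h := inner_pencil hε hω k z u (conjH1 v)
  rw [hu, inner_zero_right] at h
  rw [inner_zero_right, ← conjH1_conjH1 v, inner_pencil, form0_conjH1, form1_conjH1, form2_conjH1]
  have h2 := congrArg conj h
  simp only [map_zero, map_add, map_mul, map_pow] at h2
  rw [h2]
  ring

theorem neg_conj_mem_pencilEigenvalues {ε : Plane → ℝ → ℝ} {ω₀ ω₁ : ℝ}
    (hε : IsPermittivity ε ω₀ ω₁) {ω : ℝ} (hω : ω ∈ Set.Icc ω₀ ω₁)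
    (k : EuclideanSpace ℝ (Fin 2)) {z : ℂ} (hz : z ∈ pencilEigenvalues (pencil hε hω k)) :
    -conj z ∈ pencilEigenvalues (pencil hε hω k) := by
  obtain ⟨u, hu0, hu⟩ := hz
  refine ⟨conjH1 u, fun h => hu0 ?_, pencil_conjH1 hε hω k hu⟩
  have h0 : conjH1 0 = 0 := H1.ext (map_zero conjL2) fun _ => map_zero conjL2
  rw [← conjH1_conjH1 u, h, h0]

end BlochPencil

end

theorem theorem3p7 (ω₀ ω₁ : ℝ) (ε : BlochPencil.Plane → ℝ → ℝ)
    (hε : BlochPencil.IsPermittivity ε ω₀ ω₁) (ω : ℝ) (hω : ω ∈ Set.Icc ω₀ ω₁)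
    (k : EuclideanSpace ℝ (Fin 2)) (hk : ‖k‖ = 1) :
    BlochPencil.pencilSpectrum (BlochPencil.pencil hε hω k) =
        BlochPencil.pencilEigenvalues (BlochPencil.pencil hε hω k) ∧
      (∀ z ∈ BlochPencil.pencilSpectrum (BlochPencil.pencil hε hω k),
        FiniteDimensional ℂ (LinearMap.ker (BlochPencil.pencil hε hω k z).toLinearMap)) ∧
      (∀ z ∈ BlochPencil.pencilSpectrum (BlochPencil.pencil hε hω k),
        -z ∈ BlochPencil.pencilSpectrum (BlochPencil.pencil hε hω k) ∧
        (starRingEnd ℂ) z ∈ BlochPencil.pencilSpectrum (BlochPencil.pencil hε hω k) ∧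
        -(starRingEnd ℂ) z ∈ BlochPencil.pencilSpectrum (BlochPencil.pencil hε hω k)) := by
  have heq := BlochPencil.pencilSpectrum_eq_pencilEigenvalues hε hω k
  have hneg : ∀ {z : ℂ}, z ∈ BlochPencil.pencilSpectrum (BlochPencil.pencil hε hω k) →
      -(starRingEnd ℂ) z ∈ BlochPencil.pencilSpectrum (BlochPencil.pencil hε hω k) := fun hz =>
    -- Conjugation acts on eigenvectors while the adjoint acts on invertibility; equality of
    -- spectrum and eigenvalues lets the two symmetries be composed.
    heq ▸ BlochPencil.neg_conj_mem_pencilEigenvalues hε hω k (heq ▸ hz)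
  refine ⟨heq, fun z _ => (ContinuousLinearMap.fredholm_alternative
    (BlochPencil.isCompactOperator_one_sub_pencil hε hω k z)).2, fun z hz => ⟨?_, ?_, hneg hz⟩⟩
  -- Here `-z` is obtained as the negative conjugate of `z̄`.
  · have h := hneg (BlochPencil.conj_mem_pencilSpectrum hε hω k hz)
    rwa [Complex.conj_conj] at h
  · exact BlochPencil.conj_mem_pencilSpectrum hε hω k hz
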